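/- Let $\boldsymbol{k}$ be a finite field of characteristic $p$, let $\boldsymbol{l}/\boldsymbol{k}$ be a quadratic extension, and let $m\geqslant 1$. Put $G=\mathrm{GL}_{2m}(\boldsymbol{k})$, and let $H\simeq\mathrm{GL}_m(\boldsymbol{l})$ be the subgroup of $G$ given by the units of $\mathrm{M}_m(\boldsymbol{l})$ under an embedding of $\boldsymbol{k}$-algebras $\varphi:\mathrm{M}_m(\boldsymbol{l})\to\mathrm{M}_{2m}(\boldsymbol{k})$ (any such embedding), that is, $H=\varphi(\mathrm{GL}_m(\boldsymbol{l}))$. 1. Every double coset in $H\backslash G/H$ is fixed by $g\mapsto g^{-1}$: for all $g\in G$, $Hg^{-1}H=HgH$. 2. $(G,H)$ is a Gelfand pair: let $R$ be a field of characteristic different from $p$, and let $(\pi,V)$ be an absolutely irreducible $R$-representation of $G$ (i.e. irreducible after extension of scalars to an algebraic closure of $R$) which is $H$-distinguished, i.e. $\mathrm{Hom}_{R[H]}(\pi,R)\neq 0$, where $H$ acts trivially on $R$. Then $\dim_R\mathrm{Hom}_{R[H]}(\pi,R)=1$, and moreover $\pi\simeq\pi^\vee$, where $\pi^\vee$ is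 the contragredient representation of $G$ on $\mathrm{Hom}_R(V,R)$, $(\pi^\vee(g)\lambda)(v)=\lambda(\pi(g^{-1})v)$. -/

import Mathlib

open scoped TensorProduct

namespace TwistedLinear

/-- The subgroup `GL_m(l)` of `GL_{2m}(k)` determined by a `k`-algebra homomorphism
`φ : M_m(l) → M_{2m}(k)`: the image of the unit group of `M_m(l)`. -/
def twistedSubgroup {k l : Type*} [Field k] [Field l] [Algebra k l] {m : ℕ}
    (φ : Matrix (Fin m) (Fin m) l →ₐ[k] Matrix (Fin (2 * m)) (Fin (2 * m)) k) :
    Subgroup (Matrix.GeneralLinearGroup (Fin (2 * m)) k) :=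
  (Units.map (φ : Matrix (Fin m) (Fin m) l →* Matrix (Fin (2 * m)) (Fin (2 * m)) k)).range

section Representations

variable {R G V : Type*} [Field R] [Group G] [AddCommGroup V] [Module R V]

/-- Extension of scalars of a representation along a field extension `K / R`. -/
noncomputable def extendScalars (K : Type*) [Field K] [Algebra R K] (π : Representation R G V) :
    Representation K G (K ⊗[R] V) :=
  ((Module.End.baseChangeHom R K V : Module.End R V →ₐ[R] Module.End K (K ⊗[R] V)) :
    Module.End R V →* Module.End K (K ⊗[R] V)).comp π

/-- A representation over a field is absolutely irreducible if it is irreducible over an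
algebraic closure. -/
def IsAbsolutelyIrreducible (π : Representation R G V) : Prop :=
  (extendScalars (AlgebraicClosure R) π).IsIrreducible

/-- The `R`-vector space `Hom_{R[H]}(π, R)` of `H`-invariant linear forms on `π`. -/
abbrev InvariantForms (H : Subgroup G) (π : Representation R G V) : Type _ :=
  Representation.IntertwiningMap (π.comp H.subtype) (Representation.trivial R H R)

/-- `π` is `H`-distinguished: it admits a nonzero `H`-invariant linear form. -/
def IsDistinguished (H : Subgroup G) (π : Representation R G V) : Prop :=
  ∃ Λ : InvariantForms H π, Λ ≠ 0

end Representations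

end TwistedLinear

open Polynomial

namespace TwistedLinear


/-! ### Swapping two roots of an irreducible quadratic polynomial. -/

section Quadratic

variable {k : Type*} [Field k]

/-! Write `l = k(δ)` and let `J` be the image of the scalar matrix `δ`. By a dimension count `H` is
the centralizer of `J` in `G`, so `g⁻¹ ∈ HgH` as soon as some invertible `x` swaps `J` and `gJg⁻¹`
under conjugation. Both are roots of the irreducible polynomial `X² - tX + n`, and any two such
roots can be swapped (`exists_swap`).

For part 2, the characteristic of `R` may divide the order of `H`, so averaging over `H` is avoided.
Absolute irreducibility enters only through Burnside: the image of `π` spans `End V`. Each matrix is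
similar to its transpose, so the contragredient of `π` has the same character as `π` twisted by `g ↦
(g⁻¹)ᵀ`, and is isomorphic to it. This turns a nonzero `H`-invariant form into a nonzero `H`-fixed
vector `v` (`exists_fixed_vector_of_invariant_form`). By part 1, `φ(π(g)v) = φ(π(g⁻¹)v)` for every
invariant form `φ`, so when `φ ≠ 0` there is an isomorphism from `π` to its contragredient sending
`v` to `φ` (`exists_equiv_dual_of_invariant`). Schur's lemma makes two such isomorphisms
proportional, hence also the two forms. -/

theorem exists_linearEquiv_of_finrank_eq {L W₁ W₂ : Type*} [Field L] [Algebra k L]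
    [FiniteDimensional k L] [AddCommGroup W₁] [Module k W₁] [Module L W₁] [IsScalarTower k L W₁]
    [AddCommGroup W₂] [Module k W₂] [Module L W₂] [IsScalarTower k L W₂]
    [FiniteDimensional k W₁] [FiniteDimensional k W₂]
    (h : Module.finrank k W₁ = Module.finrank k W₂) :
    ∃ x : W₁ ≃ₗ[k] W₂, ∀ (a : L) (w : W₁), x (a • w) = a • x w := by
  have f₁ : Module.Finite L W₁ := Module.Finite.right k _ _
  have f₂ : Module.Finite L W₂ := Module.Finite.right k _ _
  rw [← Module.finrank_mul_finrank k L W₁, ← Module.finrank_mul_finrank k L W₂] at h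
  have e : W₁ ≃ₗ[L] W₂ :=
    LinearEquiv.ofFinrankEq _ _ (Nat.eq_of_mul_eq_mul_left Module.finrank_pos h)
  exact ⟨e.restrictScalars k, fun a w => e.map_smul a w⟩

/-- Two representations of a finite field extension on the same finite-dimensional space are
conjugate. -/
theorem exists_conj_of_algHom {L V : Type*} [Field L] [Algebra k L] [FiniteDimensional k L]
    [AddCommGroup V] [Module k V] [FiniteDimensional k V] (F₁ F₂ : L →ₐ[k] Module.End k V) :
    ∃ x : V ≃ₗ[k] V, ∀ a v, x (F₁ a v) = F₂ a (x v) := by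
  have t : ∀ F : L →ₐ[k] Module.End k V,
      @IsScalarTower k L V _ (Module.compHom V F.toRingHom).toSMul _ := by
    intro F
    let _ := Module.compHom V F.toRingHom
    refine IsScalarTower.of_algebraMap_smul fun c v => ?_
    change F (algebraMap k L c) v = c • v
    rw [F.commutes]
    rfl
  -- The same space carries two `L`-structures, so the instances are passed by hand.
  exact @exists_linearEquiv_of_finrank_eq k _ L V V _ _ _ _ _ (Module.compHom V F₁.toRingHom)
    (t F₁) _ _ (Module.compHom V F₂.toRingHom) (t F₂) _ _ rfl

/-- Two endomorphisms annihilated by the same irreducible polynomial are conjugate. -/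
theorem exists_conj_of_aeval_eq_zero {V : Type*} [AddCommGroup V] [Module k V]
    [FiniteDimensional k V] {q : k[X]} (hq : Irreducible q) {J₁ J₂ : Module.End k V}
    (h₁ : aeval J₁ q = 0) (h₂ : aeval J₂ q = 0) :
    ∃ x : V ≃ₗ[k] V, ∀ v, x (J₁ v) = J₂ (x v) := by
  have : Fact (Irreducible q) := ⟨hq⟩
  have : FiniteDimensional k (AdjoinRoot q) := (AdjoinRoot.powerBasis hq.ne_zero).finite
  have f : ∀ J : Module.End k V, aeval J q = 0 →
      ∃ F : AdjoinRoot q →ₐ[k] Module.End k V, F (AdjoinRoot.root q) = J := by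
    intro J hJ
    refine ⟨Ideal.Quotient.liftₐ (Ideal.span {q}) (aeval J) fun a ha => ?_, ?_⟩
    · obtain ⟨b, rfl⟩ := Ideal.mem_span_singleton'.1 ha
      rw [map_mul, hJ, mul_zero]
    · exact aeval_X J
  obtain ⟨F₁, rfl⟩ := f J₁ h₁
  obtain ⟨F₂, rfl⟩ := f J₂ h₂
  obtain ⟨x, hx⟩ := exists_conj_of_algHom F₁ F₂
  exact ⟨x, hx _⟩

/-- For a semisimple endomorphism `J` and disjoint `J`-stable subspaces `p` and `r`, there is a
projection onto `p` that kills `r` and commutes with `J`. -/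
theorem exists_commuting_projection {V : Type*} [AddCommGroup V] [Module k V]
    {J : Module.End k V} (hJ : J.IsSemisimple) {p r : Submodule k V} (hpr : Disjoint p r)
    (hp : ∀ v ∈ p, J v ∈ p) (hr : ∀ v ∈ r, J v ∈ r) :
    ∃ P : V →ₗ[k] p, (∀ v : p, P v = v) ∧ (∀ v ∈ r, P v = 0) ∧
      ∀ v, (P (J v) : V) = J (P v) := by
  obtain ⟨c, hc, hcompl⟩ := Module.End.isSemisimple_iff.1 hJ (p ⊔ r) (by
    rw [Module.End.mem_invtSubmodule]
    refine sup_le (fun v hv => ?_) (fun v hv => ?_)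
    · exact Submodule.mem_sup_left (hp v hv)
    · exact Submodule.mem_sup_right (hr v hv))
  have h : IsCompl p (r ⊔ c) :=
    ⟨hpr.disjoint_sup_right_of_disjoint_sup_left hcompl.disjoint, by
      rw [codisjoint_iff, ← sup_assoc]; exact hcompl.sup_eq_top⟩
  have hrc : ∀ v ∈ r ⊔ c, J v ∈ r ⊔ c := by
    intro v hv
    obtain ⟨a, ha, b, hb, rfl⟩ := Submodule.mem_sup.1 hv
    rw [map_add]
    exact add_mem (Submodule.mem_sup_left (hr a ha))
      (Submodule.mem_sup_right ((Module.End.mem_invtSubmodule _).1 hc hb))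
  refine ⟨p.projectionOnto _ h, fun v => Submodule.projectionOnto_apply_left h v,
    fun v hv => ?_, fun v => ?_⟩
  · exact (Submodule.projectionOnto_apply_eq_zero_iff h).2 (Submodule.mem_sup_left hv)
  · obtain ⟨a, ha, b, hb, rfl⟩ := Submodule.mem_sup.1
      (show v ∈ p ⊔ (r ⊔ c) by rw [h.sup_eq_top]; trivial)
    have e₁ := Submodule.projectionOnto_apply_left h ⟨a, ha⟩
    have e₂ := Submodule.projectionOnto_apply_left h ⟨J a, hp a ha⟩
    have e₃ := (Submodule.projectionOnto_apply_eq_zero_iff h).2 hb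
    have e₄ := (Submodule.projectionOnto_apply_eq_zero_iff h).2 (hrc b hb)
    simp only at e₁ e₂
    rw [map_add, map_add, map_add, e₁, e₂, e₃, e₄]
    simp

/-- Two roots in `End V` of an irreducible polynomial `X ^ 2 - t X + n` are interchanged by some
automorphism of `V`. -/
theorem exists_swap {t n : k} (hq : Irreducible (X ^ 2 - C t * X + C n)) (d : ℕ) :
    ∀ (V : Type*) [AddCommGroup V] [Module k V] [FiniteDimensional k V],
      Module.finrank k V = d → ∀ J₁ J₂ : Module.End k V,
      aeval J₁ (X ^ 2 - C t * X + C n) = 0 → aeval J₂ (X ^ 2 - C t * X + C n) = 0 →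
      ∃ x : V ≃ₗ[k] V, (∀ v, x (J₁ v) = J₂ (x v)) ∧ ∀ v, x (J₂ v) = J₁ (x v) := by
  induction d using Nat.strong_induction_on with
  | _ d ih =>
  intro V _ _ _ hd J₁ J₂ h₁ h₂
  have ss₁ := Module.End.isSemisimple_of_squarefree_aeval_eq_zero hq.squarefree h₁
  have ss₂ := Module.End.isSemisimple_of_squarefree_aeval_eq_zero hq.squarefree h₂
  have root_iff : ∀ {W : Type _} [AddCommGroup W] [Module k W] (J : Module.End k W),
      aeval J (X ^ 2 - C t * X + C n) = 0 ↔ ∀ v, J (J v) = t • J v - n • v := by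
    intro W _ _ J
    simp only [LinearMap.ext_iff, map_add, map_sub, map_mul, aeval_X, aeval_C,
      LinearMap.add_apply, LinearMap.sub_apply, Module.End.mul_apply, pow_two,
      Module.algebraMap_end_apply, LinearMap.zero_apply]
    refine forall_congr' fun v => ?_
    rw [← sub_eq_zero (b := t • J v - n • v)]
    abel_nf
  have r₁ := (root_iff J₁).1 h₁
  have r₂ := (root_iff J₂).1 h₂
  -- `S` already satisfies both swap relations; only its invertibility can fail. In that case
  -- induction applies to its range `I`.
  set S : Module.End k V := J₁ + J₂ - t • LinearMap.id with hS
  have Sa : ∀ v, S v = J₁ v + J₂ v - t • v := fun v => rfl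
  have S₁ : ∀ v, S (J₁ v) = J₂ (S v) := by
    intro v
    simp only [Sa, map_sub, map_add, map_smul, r₁, r₂]
    abel
  have S₂ : ∀ v, S (J₂ v) = J₁ (S v) := by
    intro v
    simp only [Sa, map_sub, map_add, map_smul, r₁, r₂]
    abel
  by_cases hsurj : Function.Surjective S
  · exact ⟨LinearEquiv.ofBijective S ⟨LinearMap.injective_iff_surjective.2 hsurj, hsurj⟩, S₁, S₂⟩
  set I := LinearMap.range S with hI
  set K := LinearMap.ker S with hK
  have hlt : Module.finrank k I < d := by
    rw [← hd]
    exact Submodule.finrank_lt (fun h => hsurj (LinearMap.range_eq_top.1 h))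
  have I₁ : ∀ v ∈ I, J₁ v ∈ I := by
    rintro _ ⟨v, rfl⟩
    exact ⟨J₂ v, S₂ v⟩
  have I₂ : ∀ v ∈ I, J₂ v ∈ I := by
    rintro _ ⟨v, rfl⟩
    exact ⟨J₁ v, S₁ v⟩
  have K₁ : ∀ v ∈ K, J₁ v ∈ K := by
    intro v hv
    rw [hK, LinearMap.mem_ker] at hv ⊢
    rw [S₁, hv, map_zero]
  have K₂ : ∀ v ∈ K, J₂ v ∈ K := by
    intro v hv
    rw [hK, LinearMap.mem_ker] at hv ⊢
    rw [S₂, hv, map_zero]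
  obtain ⟨x₀, a₁, a₂⟩ := ih _ hlt I rfl (J₁.restrict I₁) (J₂.restrict I₂)
    ((root_iff _).2 fun v => Subtype.ext (r₁ v)) ((root_iff _).2 fun v => Subtype.ext (r₂ v))
  obtain ⟨P, hP, -, hPJ⟩ := exists_commuting_projection ss₁ (p := I ⊓ K) (r := ⊥) disjoint_bot_right
    (fun v hv => ⟨I₁ v hv.1, K₁ v hv.2⟩) (by simp)
  -- A `J₁`-stable complement of `I ⊓ K` in `K`.
  let Z : Submodule k V := LinearMap.ker P ⊓ K
  have Z₁ : ∀ v ∈ Z, J₁ v ∈ Z := by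
    rintro v ⟨hv, hv'⟩
    refine ⟨?_, K₁ v hv'⟩
    have : P v = 0 := hv
    have e := hPJ v
    rw [this] at e
    exact Subtype.ext (e.trans (map_zero _))
  have Zdisj : ∀ v ∈ I, v ∈ Z → v = 0 := by
    intro v hv hz
    have e := hP ⟨v, hv, hz.2⟩
    have : P v = 0 := hz.1
    rw [this] at e
    exact (congrArg Subtype.val e).symm
  have disj : Disjoint I Z := Submodule.disjoint_def.2 Zdisj
  -- On `Z` the map `S` vanishes, so `J₂` acts there as `t - J₁`, the conjugate root.
  obtain ⟨x₂, hx₂⟩ := exists_conj_of_aeval_eq_zero hq (J₁ := J₁.restrict Z₁)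
    (J₂ := t • LinearMap.id - J₁.restrict Z₁)
    ((root_iff _).2 fun v => Subtype.ext (r₁ v))
    ((root_iff _).2 fun v => Subtype.ext (by
      simp only [LinearMap.sub_apply, LinearMap.smul_apply, LinearMap.id_apply, map_sub, map_smul,
        Submodule.coe_sub, Submodule.coe_smul, LinearMap.coe_restrict_apply, r₁]
      module))
  obtain ⟨A, hA, hAZ, hAJ⟩ := exists_commuting_projection ss₁ disj I₁ Z₁
  obtain ⟨B, hB, hBI, hBJ⟩ := exists_commuting_projection ss₁ disj.symm Z₁ I₁
  obtain ⟨Q, hQ, -, hQJ⟩ := exists_commuting_projection ss₂ (p := K) (r := ⊥) disjoint_bot_right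
    K₂ (by simp)
  obtain ⟨s₀, hs₀⟩ := LinearMap.exists_rightInverse_of_surjective S.rangeRestrict
    (LinearMap.range_rangeRestrict S)
  have hs₀' : ∀ v : I, S (s₀ v) = v := fun v => congrArg Subtype.val (LinearMap.congr_fun hs₀ v)
  -- Subtracting the `K`-component makes the section of `S` equivariant: the defect of `s₀` lies in
  -- `K`, which `1 - Q` kills.
  let s : I →ₗ[k] V := s₀ - K.subtype ∘ₗ Q ∘ₗ s₀
  have sa : ∀ v, s v = s₀ v - (Q (s₀ v) : V) := fun v => rfl
  have hs : ∀ v : I, S (s v) = v := by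
    intro v
    rw [sa, map_sub, hs₀', LinearMap.mem_ker.1 (Q (s₀ v)).2, sub_zero]
  have hsJ : ∀ v : I, s ⟨J₁ v, I₁ v v.2⟩ = J₂ (s v) := by
    intro v
    have hk : s₀ ⟨J₁ v, I₁ v v.2⟩ - J₂ (s₀ v) ∈ K := by
      rw [hK, LinearMap.mem_ker, map_sub, hs₀', S₂, hs₀', sub_self]
    have e := congrArg Subtype.val (hQ ⟨_, hk⟩)
    simp only [map_sub, Submodule.coe_sub, hQJ] at e
    rw [sa, sa, map_sub, sub_eq_sub_iff_sub_eq_sub, e]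
  -- A first approximation to `x`: it carries `J₁` to `J₂` and has the right values on `I` and `Z`,
  -- but need not satisfy `S y = x₀ S`.
  let y : V →ₗ[k] V := I.subtype ∘ₗ x₀.toLinearMap ∘ₗ A + Z.subtype ∘ₗ x₂.toLinearMap ∘ₗ B
  have ya : ∀ v, y v = (x₀ (A v) : V) + (x₂ (B v) : V) := fun v => rfl
  have hyJ : ∀ v, y (J₁ v) = J₂ (y v) := by
    intro v
    have e₁ : A (J₁ v) = J₁.restrict I₁ (A v) := Subtype.ext (hAJ v)
    have e₂ : B (J₁ v) = J₁.restrict Z₁ (B v) := Subtype.ext (hBJ v)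
    have e₃ : S (x₂ (B v)) = 0 := (x₂ (B v)).2.2
    rw [Sa] at e₃
    rw [ya, ya, e₁, e₂, a₁, hx₂, map_add]
    simp only [LinearMap.coe_restrict_apply, LinearMap.sub_apply, LinearMap.smul_apply,
      LinearMap.id_apply, Submodule.coe_sub, Submodule.coe_smul]
    rw [add_right_inj, ← sub_eq_zero, ← neg_eq_zero, ← e₃]
    abel
  -- The defect `S y - x₀ S`. It vanishes on `I` and `Z`, so subtracting `s ∘ f` repairs `y` without
  -- changing it there.
  let f : V →ₗ[k] I := S.rangeRestrict ∘ₗ y - x₀.toLinearMap ∘ₗ S.rangeRestrict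
  have fa : ∀ v, (f v : V) = S (y v) - x₀ ⟨S v, v, rfl⟩ := fun v => rfl
  have hfJ : ∀ v, f (J₁ v) = ⟨J₁ (f v), I₁ _ (f v).2⟩ := by
    intro v
    have e : (⟨S (J₁ v), J₁ v, rfl⟩ : I) = J₂.restrict I₂ ⟨S v, v, rfl⟩ := Subtype.ext (S₁ v)
    refine Subtype.ext ?_
    simp only [fa]
    rw [hyJ, S₂, e, a₂, map_sub]
    rfl
  let x : V →ₗ[k] V := y - s ∘ₗ f
  have xa : ∀ v, x v = y v - s (f v) := fun v => rfl
  have hx₁ : ∀ v, x (J₁ v) = J₂ (x v) := by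
    intro v
    rw [xa, xa, hyJ, hfJ, hsJ, map_sub]
  have hxS : ∀ v, S (x v) = x₀ ⟨S v, v, rfl⟩ := by
    intro v
    rw [xa, map_sub, hs, fa, sub_sub_cancel]
  have x₀S : ∀ v : I, S (x₀ v) = x₀ ⟨S v, v, rfl⟩ := by
    intro v
    have e : (⟨S v, v, rfl⟩ : I) = J₁.restrict I₁ v + J₂.restrict I₂ v - t • v := Subtype.ext rfl
    rw [e, map_sub, map_add, a₁, a₂, map_smul, Sa]
    simp only [Submodule.coe_sub, Submodule.coe_add, Submodule.coe_smul,
      LinearMap.coe_restrict_apply]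
    abel
  have hyI : ∀ v : I, y v = x₀ v := by
    intro v
    rw [ya, hA, hBI v v.2, map_zero, Submodule.coe_zero, add_zero]
  have hyZ : ∀ v : Z, y v = x₂ v := by
    intro v
    rw [ya, hB, hAZ v v.2, map_zero, Submodule.coe_zero, zero_add]
  have hxI : ∀ v : I, x v = x₀ v := by
    intro v
    have : f v = 0 := Subtype.ext (by rw [fa, hyI, x₀S, sub_self, Submodule.coe_zero])
    rw [xa, this, map_zero, sub_zero, hyI]
  have hxZ : ∀ v : Z, x v = x₂ v := by
    intro v
    have : f v = 0 := Subtype.ext (by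
      have e : (⟨S v, v, rfl⟩ : I) = 0 := Subtype.ext v.2.2
      have e' : S (x₂ v) = 0 := (x₂ v).2.2
      rw [fa, hyZ, e, e', map_zero, Submodule.coe_zero, sub_zero])
    rw [xa, this, map_zero, sub_zero, hyZ]
  have inj : Function.Injective x := by
    refine (injective_iff_map_eq_zero x).2 fun v hv => ?_
    -- The relation `S x = x₀ S` puts the kernel of `x` inside `K = (I ⊓ K) ⊕ Z`, where `x` is given
    -- by the injective maps `x₀` and `x₂` with images in the disjoint spaces `I` and `Z`.
    have h0 : S v = 0 := by
      have e := hxS v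
      rw [hv, map_zero] at e
      exact congrArg Subtype.val ((map_eq_zero_iff x₀ x₀.injective).1 (Subtype.ext e.symm))
    have hz : v - P v ∈ Z := by
      refine ⟨?_, sub_mem h0 (P v).2.2⟩
      rw [SetLike.mem_coe, LinearMap.mem_ker, map_sub, hP, sub_self]
    have e₁ := hxI ⟨P v, (P v).2.1⟩
    have e₂ := hxZ ⟨_, hz⟩
    have e₃ : ((x₀ ⟨P v, (P v).2.1⟩ : I) : V) + (x₂ ⟨_, hz⟩ : Z) = 0 := by
      rw [← e₁, ← e₂, ← map_add, add_sub_cancel, hv]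
    have e₄ : ((x₂ ⟨_, hz⟩ : Z) : V) = 0 := by
      refine Zdisj _ ?_ (x₂ ⟨_, hz⟩).2
      rw [← neg_eq_of_add_eq_zero_right e₃]
      exact neg_mem (x₀ _).2
    have e₅ := (map_eq_zero_iff x₂ x₂.injective).1 (Subtype.ext e₄)
    rw [e₄, add_zero] at e₃
    have e₆ := (map_eq_zero_iff x₀ x₀.injective).1 (Subtype.ext e₃)
    have e₇ : (P v : V) = 0 := congrArg Subtype.val e₆
    have e₈ : v - P v = 0 := congrArg Subtype.val e₅
    rwa [e₇, sub_zero] at e₈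
  refine ⟨LinearEquiv.ofBijective x ⟨inj, LinearMap.injective_iff_surjective.1 inj⟩, hx₁,
    fun v => ?_⟩
  change x (J₂ v) = J₁ (x v)
  -- The second swap relation follows from the first, since `x` commutes with `S`.
  have e : J₂ v = S v + t • v - J₁ v := by rw [Sa]; abel
  have e' := hxI ⟨S v, v, rfl⟩
  rw [e, map_sub, map_add, map_smul, hx₁, e', ← hxS, Sa]
  abel

end Quadratic


/-! ### Similarity of a matrix and its transpose. -/

section SelfDual

variable {k : Type*} [Field k]

/-- `N` carries a nondegenerate `k`-bilinear form for which `k[X]` acts by self-adjoint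
operators. -/
def HasSelfAdjointForm (k N : Type*) [Field k] [AddCommGroup N] [Module k N] [Module k[X] N] :
    Prop :=
  ∃ B : N →ₗ[k] N →ₗ[k] k, (∀ (a : k[X]) (x y : N), B (a • x) y = B x (a • y)) ∧
    ∀ x, (∀ y, B x y = 0) → x = 0

theorem HasSelfAdjointForm.of_equiv {N N' : Type*} [AddCommGroup N] [Module k N] [Module k[X] N]
    [IsScalarTower k k[X] N] [AddCommGroup N'] [Module k N'] [Module k[X] N']
    [IsScalarTower k k[X] N'] (e : N' ≃ₗ[k[X]] N) (h : HasSelfAdjointForm k N) :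
    HasSelfAdjointForm k N' := by
  obtain ⟨B, h₁, h₂⟩ := h
  let e' : N' ≃ₗ[k] N := e.restrictScalars k
  refine ⟨B.compl₁₂ e'.toLinearMap e'.toLinearMap, fun a x y => ?_, fun x hx => ?_⟩
  · change B (e (a • x)) (e y) = B (e x) (e (a • y))
    rw [e.map_smul, e.map_smul, h₁]
  · refine (map_eq_zero_iff e e.injective).1 (h₂ _ fun y => ?_)
    have := hx (e.symm y)
    change B (e x) (e (e.symm y)) = 0 at this
    rwa [e.apply_symm_apply] at this

theorem HasSelfAdjointForm.pi {ι : Type*} [Fintype ι] {N : ι → Type*} [∀ i, AddCommGroup (N i)]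
    [∀ i, Module k (N i)] [∀ i, Module k[X] (N i)] (h : ∀ i, HasSelfAdjointForm k (N i)) :
    HasSelfAdjointForm k (∀ i, N i) := by
  classical
  choose B h₁ h₂ using h
  let T : (∀ i, N i) →ₗ[k] (∀ i, N i) →ₗ[k] k :=
    ∑ i, (B i).compl₁₂ (LinearMap.proj i) (LinearMap.proj i)
  have hT : ∀ x y, T x y = ∑ i, B i (x i) (y i) := fun x y => by simp [T, LinearMap.sum_apply]
  refine ⟨T, fun a x y => ?_, fun x hx => ?_⟩
  · simp only [hT, Pi.smul_apply, h₁]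
  · refine funext fun i => h₂ i _ fun y => ?_
    have e := hx (Pi.single i y)
    rw [hT, Finset.sum_eq_single i] at e
    · rwa [Pi.single_eq_same] at e
    · intro j _ hj
      rw [Pi.single_eq_of_ne hj, map_zero]
    · intro hi
      exact absurd (Finset.mem_univ i) hi

/-- Every nonzero element of `k[X]/(p^(e+1))` has the socle element `p^e` as a multiple: the gcd of
`a` and `p^(e+1)` is `p^j` up to a unit with `j ≤ e`, and Bézout is multiplied by `p^(e-j)`. -/
theorem exists_mul_eq_of_not_dvd {p : k[X]} (hp : Irreducible p) {e : ℕ} {a : k[X]}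
    (ha : ¬ p ^ (e + 1) ∣ a) : ∃ b, p ^ (e + 1) ∣ b * a - p ^ e := by
  classical
  obtain ⟨j, hj, u, hu⟩ := (dvd_prime_pow hp.prime (e + 1)).1
    (EuclideanDomain.gcd_dvd_right a (p ^ (e + 1)))
  have hje : j ≤ e := by
    by_contra hlt
    have : j = e + 1 := by omega
    subst this
    exact ha (hu ▸ (Units.mul_right_dvd.2 (EuclideanDomain.gcd_dvd_left a (p ^ (e + 1)))))
  have hb := EuclideanDomain.gcd_eq_gcd_ab a (p ^ (e + 1))
  refine ⟨EuclideanDomain.gcdA a (p ^ (e + 1)) * u * p ^ (e - j),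
    -(EuclideanDomain.gcdB a (p ^ (e + 1)) * u * p ^ (e - j)), ?_⟩
  have : p ^ e = p ^ j * p ^ (e - j) := by rw [← pow_add, Nat.add_sub_cancel' hje]
  rw [this, ← hu, hb]
  ring

theorem hasSelfAdjointForm_quotient {p : k[X]} (hp : Irreducible p) (e : ℕ) :
    HasSelfAdjointForm k (k[X] ⧸ Ideal.span {p ^ e}) := by
  cases e with
  | zero =>
    refine ⟨0, fun _ _ _ => rfl, fun x _ => ?_⟩
    have : Subsingleton (k[X] ⧸ Ideal.span {p ^ 0}) := by
      rw [Ideal.Quotient.subsingleton_iff, pow_zero, Ideal.span_singleton_one]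
    exact Subsingleton.elim _ _
  | succ e =>
    have hne : (Ideal.Quotient.mk (Ideal.span {p ^ (e + 1)}) (p ^ e)) ≠ 0 := by
      rw [Ne, Ideal.Quotient.eq_zero_iff_mem, Ideal.mem_span_singleton,
        pow_dvd_pow_iff hp.ne_zero hp.not_isUnit]
      omega
    -- The form is `(x, y) ↦ f(xy)`; a functional nonzero on the socle element `p^e` makes it
    -- nondegenerate.
    obtain ⟨f, hf⟩ := not_forall.1 (mt (Module.forall_dual_apply_eq_zero_iff k _).1 hne)
    refine ⟨(LinearMap.mul k (k[X] ⧸ Ideal.span {p ^ (e + 1)})).compr₂ f, fun a x y => ?_,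
      fun x hx => ?_⟩
    · obtain ⟨x, rfl⟩ := Ideal.Quotient.mk_surjective x
      obtain ⟨y, rfl⟩ := Ideal.Quotient.mk_surjective y
      exact congrArg (fun z => f (Ideal.Quotient.mk _ z))
        (show a * x * y = x * (a * y) by ring)
    · obtain ⟨a, rfl⟩ := Ideal.Quotient.mk_surjective x
      by_contra h
      rw [Ideal.Quotient.eq_zero_iff_mem, Ideal.mem_span_singleton] at h
      obtain ⟨b, hb⟩ := exists_mul_eq_of_not_dvd hp h
      have e₁ := hx (Ideal.Quotient.mk _ b)
      rw [LinearMap.compr₂_apply, LinearMap.mul_apply', ← map_mul, mul_comm,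
        Ideal.Quotient.eq.2 (Ideal.mem_span_singleton.2 hb)] at e₁
      exact hf e₁

theorem hasSelfAdjointForm_of_isTorsion {M : Type*} [AddCommGroup M] [Module k M] [Module k[X] M]
    [IsScalarTower k k[X] M] [Module.Finite k[X] M] (hM : Module.IsTorsion k[X] M) :
    HasSelfAdjointForm k M := by
  classical
  obtain ⟨ι, _, p, hp, e, ⟨f⟩⟩ := Module.equiv_directSum_of_isTorsion hM
  exact (HasSelfAdjointForm.pi fun i => hasSelfAdjointForm_quotient (hp i) (e i)).of_equiv
    (f.trans (DirectSum.linearEquivFunOnFintype k[X] ι _))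

/-- Every square matrix over a field is similar to its transpose. -/
theorem exists_mul_eq_transpose_mul {ι : Type*} [Fintype ι] [DecidableEq ι] (A : Matrix ι ι k) :
    ∃ P : Matrix.GeneralLinearGroup ι k, (P : Matrix ι ι k) * A = A.transpose * P := by
  let a : Module.End k (ι → k) := Matrix.toLin' A
  obtain ⟨B, h₁, h₂⟩ := hasSelfAdjointForm_of_isTorsion
    (Module.AEval.isTorsion_of_finiteDimensional k (ι → k) a)
  let E := Module.AEval'.of a
  let B' : (ι → k) →ₗ[k] (ι → k) →ₗ[k] k := B.compl₁₂ E.toLinearMap E.toLinearMap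
  have hB' : ∀ x y, B' (A.mulVec x) y = B' x (A.mulVec y) := by
    intro x y
    change B (E (a x)) (E y) = B (E x) (E (a y))
    rw [← Module.AEval'.X_smul_of, ← Module.AEval'.X_smul_of, h₁]
  have hn : ∀ x, (∀ y, B' x y = 0) → x = 0 := by
    intro x hx
    refine (map_eq_zero_iff E E.injective).1 (h₂ _ fun y => ?_)
    have := hx (E.symm y)
    change B (E x) (E (E.symm y)) = 0 at this
    rwa [E.apply_symm_apply] at this
  -- The Gram matrix of the form: self-adjointness of `A` reads `P A = Aᵀ P`.
  let P := LinearMap.toMatrix₂' k B'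
  have hP : ∀ x y, x ⬝ᵥ P.mulVec y = B' x y := by
    intro x y
    rw [← Matrix.toLinearMap₂'_apply', Matrix.toLinearMap₂'_toMatrix']
  have hdet : IsUnit P := by
    rw [← Matrix.isUnit_transpose, ← Matrix.mulVec_injective_iff_isUnit]
    refine (injective_iff_map_eq_zero (Matrix.mulVecLin P.transpose)).2 fun x hx => hn x fun y => ?_
    rw [Matrix.mulVecLin_apply, Matrix.mulVec_transpose] at hx
    rw [← hP, Matrix.dotProduct_mulVec, hx, zero_dotProduct]
  refine ⟨hdet.unit, ?_⟩
  rw [IsUnit.unit_spec]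
  refine Matrix.ext_of_mulVec_single fun j => dotProduct_eq _ _ fun x => ?_
  rw [dotProduct_comm _ x, dotProduct_comm _ x, ← Matrix.mulVec_mulVec, ← Matrix.mulVec_mulVec, hP,
    ← hB', ← hP, Matrix.dotProduct_mulVec x A.transpose, Matrix.vecMul_transpose]

end SelfDual


/-! ### The centralizer of an embedded field. -/

section Centralizer

variable {k L : Type*} [Field k] [Field L] [Algebra k L] [FiniteDimensional k L]

/-- Matrices commute with scalars, so `ψ` lands in `End_L(V)`. Both sides have `k`-dimension `m² [L
: k]`, so injectivity forces surjectivity. -/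
theorem exists_eq_of_map_smul {V : Type*} [AddCommGroup V] [Module k V] [Module L V]
    [IsScalarTower k L V] [FiniteDimensional k V] {m : ℕ} (hV : Module.finrank L V = m)
    {ψ : Matrix (Fin m) (Fin m) L →ₐ[k] Module.End k V} (hψ : Function.Injective ψ)
    (hs : ∀ (a : L) (v : V), ψ (Matrix.scalar (Fin m) a) v = a • v) {x : Module.End k V}
    (hx : ∀ (a : L) (v : V), x (a • v) = a • x v) : ∃ y, ψ y = x := by
  have : FiniteDimensional L V := Module.Finite.right k _ _
  let Θ : Matrix (Fin m) (Fin m) L →ₗ[k] (V →ₗ[L] V) :=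
    { toFun := fun y =>
        { toFun := ψ y
          map_add' := map_add _
          map_smul' := fun a v => by
            rw [RingHom.id_apply, ← hs, ← hs, ← Module.End.mul_apply, ← Module.End.mul_apply,
              ← map_mul, ← map_mul, (Matrix.scalar_commute a (Commute.all a) y).eq] }
      map_add' := fun y z => LinearMap.ext fun v => by
        change ψ (y + z) v = ψ y v + ψ z v
        rw [map_add, LinearMap.add_apply]
      map_smul' := fun c y => LinearMap.ext fun v => by
        change ψ (c • y) v = c • ψ y v
        rw [map_smul, LinearMap.smul_apply] }
  have hΘ : Function.Injective Θ := by
    intro y z h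
    exact hψ (LinearMap.ext fun v => LinearMap.congr_fun h v)
  have hfin : FiniteDimensional k (V →ₗ[L] V) := Module.Finite.trans L _
  have hd : Module.finrank k (Matrix (Fin m) (Fin m) L) = Module.finrank k (V →ₗ[L] V) := by
    rw [← Module.finrank_mul_finrank k L (V →ₗ[L] V), Module.finrank_linearMap, hV,
      Module.finrank_matrix, Fintype.card_fin, mul_comm]
  obtain ⟨y, hy⟩ := (LinearMap.injective_iff_surjective_of_finrank_eq_finrank hd).1 hΘ
    { x with map_smul' := hx }
  exact ⟨y, LinearMap.ext fun v => LinearMap.congr_fun hy v⟩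

theorem exists_eq_of_commute_scalar {V : Type*} [AddCommGroup V] [Module k V]
    [FiniteDimensional k V] {m : ℕ} (hV : Module.finrank k V = Module.finrank k L * m)
    {ψ : Matrix (Fin m) (Fin m) L →ₐ[k] Module.End k V} (hψ : Function.Injective ψ)
    {x : Module.End k V} (hx : ∀ a, Commute x (ψ (Matrix.scalar (Fin m) a))) :
    ∃ y, ψ y = x := by
  let _ : Module L V := Module.compHom V (ψ.toRingHom.comp (Matrix.scalar (Fin m)))
  have : IsScalarTower k L V := by
    refine IsScalarTower.of_algebraMap_smul fun c v => ?_
    change ψ (algebraMap k (Matrix (Fin m) (Fin m) L) c) v = c • v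
    rw [ψ.commutes]
    rfl
  refine exists_eq_of_map_smul (L := L) ?_ hψ (fun a v => rfl)
    fun a v => LinearMap.congr_fun (hx a).eq v
  rw [← Module.finrank_mul_finrank k L V] at hV
  exact Nat.eq_of_mul_eq_mul_left Module.finrank_pos hV

end Centralizer

/-! ### The subgroup as a centralizer, and its double cosets. -/

section Twisted

variable {k l : Type*} [Field k] [Field l] [Algebra k l] {m : ℕ}

theorem mem_twistedSubgroup_iff (hl : Module.finrank k l = 2) (hm : 1 ≤ m)
    (φ : Matrix (Fin m) (Fin m) l →ₐ[k] Matrix (Fin (2 * m)) (Fin (2 * m)) k) {δ : l}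
    (hδ : Algebra.adjoin k {δ} = ⊤) (h : Matrix.GeneralLinearGroup (Fin (2 * m)) k) :
    h ∈ twistedSubgroup φ ↔
      h.val * φ (Matrix.scalar (Fin m) δ) = φ (Matrix.scalar (Fin m) δ) * h.val := by
  have : FiniteDimensional k l := Module.finite_of_finrank_pos (by omega)
  have : Nonempty (Fin m) := ⟨⟨0, hm⟩⟩
  have : Nonempty (Fin (2 * m)) := ⟨⟨0, by omega⟩⟩
  have inj : Function.Injective φ := φ.toRingHom.injective
  constructor
  · rintro ⟨u, rfl⟩
    change φ u.val * _ = _ * φ u.val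
    rw [← map_mul, ← map_mul, (Matrix.scalar_commute δ (Commute.all δ) u.val).eq]
  · intro hc
    have surj : ∀ x : Matrix (Fin (2 * m)) (Fin (2 * m)) k,
        Commute x (φ (Matrix.scalar (Fin m) δ)) → ∃ y, φ y = x := by
      intro x hx
      have hx' : ∀ a, Commute x (φ (Matrix.scalar (Fin m) a)) := by
        intro a
        have ha : a ∈ Algebra.adjoin k {δ} := hδ ▸ trivial
        induction ha using Algebra.adjoin_induction with
        | mem b hb => rwa [Set.mem_singleton_iff.1 hb]
        | algebraMap c =>
          change Commute x (φ (algebraMap k (Matrix (Fin m) (Fin m) l) c))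
          rw [φ.commutes]
          exact (Algebra.commutes c x).symm
        | add a b _ _ ha hb => rw [map_add, map_add]; exact ha.add_right hb
        | mul a b _ _ ha hb => rw [map_mul, map_mul]; exact ha.mul_right hb
      let E : Matrix (Fin (2 * m)) (Fin (2 * m)) k ≃ₐ[k] Module.End k (Fin (2 * m) → k) :=
        Matrix.toLinAlgEquiv'
      obtain ⟨y, hy⟩ := exists_eq_of_commute_scalar (L := l) (m := m)
        (V := Fin (2 * m) → k) (by rw [hl, Module.finrank_fin_fun])
        (ψ := E.toAlgHom.comp φ) (E.injective.comp inj) (x := E x)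
        fun a => (hx' a).map E
      exact ⟨y, E.injective hy⟩
    obtain ⟨y, hy⟩ := surj h.val hc
    obtain ⟨z, hz⟩ := surj h⁻¹.val ((show Commute h.val _ from hc).units_inv_left)
    -- Lifting both `h` and `h⁻¹` makes the preimage a unit.
    refine ⟨⟨y, z, inj ?_, inj ?_⟩, Units.ext hy⟩
    · rw [map_mul, hy, hz, map_one, Units.mul_inv]
    · rw [map_mul, hy, hz, map_one, Units.inv_mul]

/-- Two matrices that are roots of an irreducible polynomial `X ^ 2 - t X + n` are interchanged
under conjugation by some invertible matrix. -/
theorem exists_matrix_swap {t n : k} (hq : Irreducible (X ^ 2 - C t * X + C n)) {ι : Type*}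
    [Fintype ι] [DecidableEq ι] {J₁ J₂ : Matrix ι ι k}
    (h₁ : aeval J₁ (X ^ 2 - C t * X + C n) = 0) (h₂ : aeval J₂ (X ^ 2 - C t * X + C n) = 0) :
    ∃ x : Matrix.GeneralLinearGroup ι k, x.val * J₁ = J₂ * x.val ∧ x.val * J₂ = J₁ * x.val := by
  let E : Matrix ι ι k ≃ₐ[k] Module.End k (ι → k) := Matrix.toLinAlgEquiv'
  have hE : ∀ J : Matrix ι ι k, aeval J (X ^ 2 - C t * X + C n) = 0 →
      aeval (E J) (X ^ 2 - C t * X + C n) = 0 := fun J hJ => by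
    rw [aeval_algHom_apply, hJ, map_zero]
  obtain ⟨x, e₁, e₂⟩ := exists_swap hq _ (ι → k) rfl (E J₁) (E J₂) (hE _ h₁) (hE _ h₂)
  refine ⟨⟨E.symm x.toLinearMap, E.symm x.symm.toLinearMap, ?_, ?_⟩, ?_, ?_⟩
  · rw [← map_mul, Module.End.mul_eq_comp, LinearEquiv.comp_symm]
    exact map_one E.symm
  · rw [← map_mul, Module.End.mul_eq_comp, LinearEquiv.symm_comp]
    exact map_one E.symm
  · change E.symm x.toLinearMap * J₁ = J₂ * E.symm x.toLinearMap
    apply E.injective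
    rw [map_mul, map_mul, E.apply_symm_apply]
    exact LinearMap.ext e₁
  · change E.symm x.toLinearMap * J₂ = J₁ * E.symm x.toLinearMap
    apply E.injective
    rw [map_mul, map_mul, E.apply_symm_apply]
    exact LinearMap.ext e₂

theorem exists_inv_eq_mul_mul [Finite k] (hl : Module.finrank k l = 2) (hm : 1 ≤ m)
    (φ : Matrix (Fin m) (Fin m) l →ₐ[k] Matrix (Fin (2 * m)) (Fin (2 * m)) k) :
    ∃ J : Matrix (Fin (2 * m)) (Fin (2 * m)) k,
      (∀ h, h ∈ twistedSubgroup φ ↔ h.val * J = J * h.val) ∧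
      ∀ g, ∃ a ∈ twistedSubgroup φ, ∃ b ∈ twistedSubgroup φ, g⁻¹ = a * g * b := by
  have : FiniteDimensional k l := Module.finite_of_finrank_pos (by omega)
  -- A finite field is perfect, so `l` has a primitive element over `k`.
  let pb := Field.powerBasisOfFiniteOfSeparable k l
  have hq := minpoly.irreducible (Algebra.IsIntegral.isIntegral (R := k) pb.gen)
  have hmon := minpoly.monic (Algebra.IsIntegral.isIntegral (R := k) pb.gen)
  have hdeg : (minpoly k pb.gen).natDegree = 2 := by
    rw [pb.natDegree_minpoly, ← pb.finrank, hl]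
  obtain ⟨t, n, htn⟩ : ∃ t n, minpoly k pb.gen = X ^ 2 - C t * X + C n := by
    refine ⟨-(minpoly k pb.gen).coeff 1, (minpoly k pb.gen).coeff 0, ?_⟩
    have h2 : (minpoly k pb.gen).coeff 2 = 1 := by rw [← hdeg]; exact hmon.coeff_natDegree
    conv_lhs => rw [eq_quadratic_of_degree_le_two (natDegree_le_iff_degree_le.1 hdeg.le), h2]
    simp
  rw [htn] at hq
  have hmem := mem_twistedSubgroup_iff hl hm φ pb.adjoin_gen_eq_top
  set J := φ (Matrix.scalar (Fin m) pb.gen) with hJ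
  have hroot : aeval J (X ^ 2 - C t * X + C n) = 0 := by
    rw [← htn, hJ, aeval_algHom_apply]
    have e := aeval_algHom_apply (Matrix.scalarAlgHom (Fin m) k (α := l)) pb.gen
      (minpoly k pb.gen)
    rw [minpoly.aeval, map_zero] at e
    exact (congrArg φ e).trans (map_zero φ)
  refine ⟨J, hmem, fun g => ?_⟩
  have hroot' : aeval (g.val * J * g⁻¹.val) (X ^ 2 - C t * X + C n) = 0 := by
    have e : aeval (g.val * J * g⁻¹.val) (X ^ 2 - C t * X + C n) =
        g.val * aeval J (X ^ 2 - C t * X + C n) * g⁻¹.val := by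
      simp only [map_add, map_sub, map_mul, aeval_X, aeval_C, pow_two, mul_add, add_mul, mul_sub,
        sub_mul, mul_assoc, Units.inv_mul_cancel_left, Algebra.algebraMap_eq_smul_one,
        smul_mul_assoc, mul_smul_comm, one_mul, Units.mul_inv]
    rw [e, hroot, mul_zero, zero_mul]
  obtain ⟨x, e₁, e₂⟩ := exists_matrix_swap hq hroot hroot'
  -- As `x` swaps `J` and `gJg⁻¹`, both `g⁻¹x` and `xg` centralize `J`.
  have m₁ : g⁻¹ * x ∈ twistedSubgroup φ := by
    rw [hmem, Units.val_mul, mul_assoc, e₁]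
    simp only [← mul_assoc, Units.inv_mul, one_mul]
  have m₂ : x * g ∈ twistedSubgroup φ := by
    rw [hmem, Units.val_mul, ← mul_assoc, ← e₂]
    simp only [mul_assoc, Units.inv_mul, mul_one]
  exact ⟨g⁻¹ * x, m₁, (x * g)⁻¹, inv_mem m₂, by group⟩

end Twisted


/-! ### Representations whose image spans the endomorphism algebra. -/

section Spanning

variable {R G V W : Type*} [Field R] [Group G] [AddCommGroup V] [Module R V]
  [AddCommGroup W] [Module R W]

theorem exists_dual_eq_one {v : V} (hv : v ≠ 0) : ∃ φ : Module.Dual R V, φ v = 1 := by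
  obtain ⟨φ, hφ⟩ := not_forall.1 (mt (Module.forall_dual_apply_eq_zero_iff R v).1 hv)
  exact ⟨(φ v)⁻¹ • φ, inv_mul_cancel₀ hφ⟩

/-- Testing against the rank-one map `w ↦ φ(w)v` gives trace `φ(Xv)`. -/
theorem eq_zero_of_trace_mul_eq_zero [FiniteDimensional R V] {X : Module.End R V}
    (hX : ∀ Y, LinearMap.trace R V (X * Y) = 0) : X = 0 := by
  refine LinearMap.ext fun v => (Module.forall_dual_apply_eq_zero_iff R _).1 fun φ => ?_
  have e : X * φ.smulRight v = φ.smulRight (X v) := LinearMap.ext fun w => by simp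
  rw [← LinearMap.trace_smulRight, ← e, hX]

theorem asAlgebraHom_surjective {ρ : Representation R G V}
    (h : Submodule.span R (Set.range ρ) = ⊤) : Function.Surjective ρ.asAlgebraHom := by
  rw [← AlgHom.coe_toLinearMap, ← LinearMap.range_eq_top, eq_top_iff, ← h, Submodule.span_le]
  rintro _ ⟨g, rfl⟩
  exact ⟨MonoidAlgebra.of R G g, ρ.asAlgebraHom_of g⟩

theorem exists_asAlgebraHom_apply_eq {ρ : Representation R G V}
    (h : Submodule.span R (Set.range ρ) = ⊤) {v : V} (hv : v ≠ 0) (x : V) :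
    ∃ f, ρ.asAlgebraHom f v = x := by
  obtain ⟨φ, hφ⟩ := exists_dual_eq_one (R := R) hv
  obtain ⟨f, hf⟩ := asAlgebraHom_surjective h (φ.smulRight x)
  exact ⟨f, by rw [hf, LinearMap.smulRight_apply, hφ, one_smul]⟩

theorem span_range_dual_eq_top [FiniteDimensional R V] {ρ : Representation R G V}
    (h : Submodule.span R (Set.range ρ) = ⊤) : Submodule.span R (Set.range ρ.dual) = ⊤ := by
  let T : Module.End R V →ₗ[R] Module.End R (Module.Dual R V) := Module.Dual.transpose
  have hr : Set.range ρ.dual = T '' Set.range ρ := by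
    rw [← Set.range_comp]
    refine Set.eq_of_subset_of_subset ?_ ?_
    · rintro _ ⟨g, rfl⟩
      exact ⟨g⁻¹, rfl⟩
    · rintro _ ⟨g, rfl⟩
      exact ⟨g⁻¹, by rw [Representation.dual_apply, inv_inv]; rfl⟩
  have surj : Function.Surjective T := by
    intro Y
    let ev := Module.evalEquiv R V
    refine ⟨ev.symm.toLinearMap ∘ₗ Module.Dual.transpose (R := R) Y ∘ₗ ev.toLinearMap, ?_⟩
    refine LinearMap.ext fun φ => LinearMap.ext fun v => ?_
    change φ (ev.symm (Module.Dual.transpose (R := R) Y (ev v))) = Y φ v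
    exact LinearMap.congr_fun (ev.apply_symm_apply (Module.Dual.transpose (R := R) Y (ev v))) φ
  rw [hr, Submodule.span_image, h, Submodule.map_top, LinearMap.range_eq_top.2 surj]

/-- An equivariant map is determined on a cyclic vector; it exists as soon as annihilators are
compatible, and is then bijective. -/
theorem exists_equiv_of_annihilator_le {ρ : Representation R G V} {σ : Representation R G W}
    (hρ : Submodule.span R (Set.range ρ) = ⊤) (hσ : Submodule.span R (Set.range σ) = ⊤)
    {v : V} {w : W} (hv : v ≠ 0) (hw : w ≠ 0)
    (h : ∀ f : MonoidAlgebra R G, ρ.asAlgebraHom f v = 0 → σ.asAlgebraHom f w = 0) :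
    ∃ T : V ≃ₗ[R] W, (∀ g x, T (ρ g x) = σ g (T x)) ∧ T v = w := by
  let A : MonoidAlgebra R G →ₗ[R] V := (LinearMap.applyₗ v) ∘ₗ ρ.asAlgebraHom.toLinearMap
  let B : MonoidAlgebra R G →ₗ[R] W := (LinearMap.applyₗ w) ∘ₗ σ.asAlgebraHom.toLinearMap
  have hA : Function.Surjective A := exists_asAlgebraHom_apply_eq hρ hv
  obtain ⟨s, hs⟩ := LinearMap.exists_rightInverse_of_surjective A (LinearMap.range_eq_top.2 hA)
  -- This is `ρ(f)v ↦ σ(f)w`; the annihilator hypothesis removes the dependence on the section `s`.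
  let T : V →ₗ[R] W := B ∘ₗ s
  have hT : ∀ f, T (ρ.asAlgebraHom f v) = σ.asAlgebraHom f w := by
    intro f
    have e : ρ.asAlgebraHom (s (ρ.asAlgebraHom f v) - f) v = 0 := by
      rw [map_sub, LinearMap.sub_apply, sub_eq_zero]
      exact LinearMap.congr_fun hs _
    have e' := h _ e
    rwa [map_sub, LinearMap.sub_apply, sub_eq_zero] at e'
  have hTv : T v = w := by simpa using hT 1
  have hTf : ∀ f x, T (ρ.asAlgebraHom f x) = σ.asAlgebraHom f (T x) := by
    intro f x
    obtain ⟨f', rfl⟩ := hA x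
    change T (ρ.asAlgebraHom f (ρ.asAlgebraHom f' v)) = σ.asAlgebraHom f (T (ρ.asAlgebraHom f' v))
    rw [hT, ← Module.End.mul_apply, ← Module.End.mul_apply, ← map_mul, ← map_mul, hT]
  refine ⟨LinearEquiv.ofBijective T ⟨?_, ?_⟩, fun g x => ?_, hTv⟩
  · refine (injective_iff_map_eq_zero T).2 fun x hx => ?_
    by_contra hx0
    obtain ⟨f, hf⟩ := exists_asAlgebraHom_apply_eq hρ hx0 v
    apply hw
    rw [← hTv, ← hf, hTf, hx, map_zero]
  · intro y
    obtain ⟨f, rfl⟩ := exists_asAlgebraHom_apply_eq hσ hw y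
    exact ⟨_, hT f⟩
  · have e := hTf (MonoidAlgebra.of R G g) x
    rwa [Representation.asAlgebraHom_of, Representation.asAlgebraHom_of] at e

/-- Representations whose images span the endomorphism algebra are determined by their
characters. -/
theorem exists_equiv_of_trace_eq [FiniteDimensional R V] [FiniteDimensional R W] [Nontrivial V]
    {ρ : Representation R G V} {σ : Representation R G W}
    (hρ : Submodule.span R (Set.range ρ) = ⊤) (hσ : Submodule.span R (Set.range σ) = ⊤)
    (h : ∀ g, LinearMap.trace R V (ρ g) = LinearMap.trace R W (σ g)) :
    ∃ T : V ≃ₗ[R] W, ∀ g x, T (ρ g x) = σ g (T x) := by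
  have htr : ∀ f, LinearMap.trace R V (ρ.asAlgebraHom f) =
      LinearMap.trace R W (σ.asAlgebraHom f) := by
    intro f
    induction f using MonoidAlgebra.induction_on with
    | of g => simpa using h g
    | add f f' hf hf' => simp only [map_add, hf, hf']
    | smul r f hf => simp only [map_smul, hf]
  have kerEq : ∀ f, ρ.asAlgebraHom f = 0 ↔ σ.asAlgebraHom f = 0 := by
    intro f
    constructor
    · refine fun hf => eq_zero_of_trace_mul_eq_zero fun Y => ?_
      obtain ⟨f', rfl⟩ := asAlgebraHom_surjective hσ Y
      rw [← map_mul, ← htr, map_mul, hf, zero_mul, map_zero]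
    · refine fun hf => eq_zero_of_trace_mul_eq_zero fun Y => ?_
      obtain ⟨f', rfl⟩ := asAlgebraHom_surjective hρ Y
      rw [← map_mul, htr, map_mul, hf, zero_mul, map_zero]
  obtain ⟨v, hv⟩ := exists_ne (0 : V)
  obtain ⟨φ, hφ⟩ := exists_dual_eq_one (R := R) hv
  -- Under `ρ`, `e` projects onto the line of `v`, so `f v = 0` forces `ρ(fe) = 0`, hence `σ(fe) =
  -- 0`. Any nonzero vector `σ(e)u` can thus be matched with `v`.
  obtain ⟨e, he⟩ := asAlgebraHom_surjective hρ (φ.smulRight v)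
  have hne : σ.asAlgebraHom e ≠ 0 := by
    rw [Ne, ← kerEq, he]
    intro h0
    have := LinearMap.congr_fun h0 v
    rw [LinearMap.smulRight_apply, hφ, one_smul] at this
    exact hv this
  obtain ⟨u, hu⟩ := DFunLike.ne_iff.1 hne
  obtain ⟨T, hT, -⟩ := exists_equiv_of_annihilator_le hρ hσ hv hu fun f hf => by
    have : ρ.asAlgebraHom (f * e) = 0 := by
      rw [map_mul, he]
      refine LinearMap.ext fun x => ?_
      rw [Module.End.mul_apply, LinearMap.smulRight_apply, map_smul, hf, smul_zero,
        LinearMap.zero_apply]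
    rw [kerEq, map_mul] at this
    exact LinearMap.congr_fun this u
  exact ⟨T, hT⟩

/-- A set of endomorphisms spans as soon as its orthogonal for the trace form is zero. -/
theorem span_eq_top_of_trace_mul [FiniteDimensional R V] {s : Set (Module.End R V)}
    (h : ∀ X, (∀ Y ∈ s, LinearMap.trace R V (X * Y) = 0) → X = 0) : Submodule.span R s = ⊤ := by
  by_contra hs
  obtain ⟨φ, hφ, hφs⟩ := Submodule.exists_dual_map_eq_bot_of_lt_top (lt_top_iff_ne_top.2 hs)
    inferInstance
  let T : Module.End R V →ₗ[R] Module.Dual R (Module.End R V) :=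
    (LinearMap.mul R (Module.End R V)).compr₂ (LinearMap.trace R V)
  have inj : Function.Injective T := (injective_iff_map_eq_zero T).2 fun X hX =>
    eq_zero_of_trace_mul_eq_zero fun Y => LinearMap.congr_fun hX Y
  obtain ⟨X, rfl⟩ := (LinearMap.injective_iff_surjective_of_finrank_eq_finrank
    Subspace.dual_finrank_eq.symm).1 inj φ
  refine hφ ?_
  rw [h X fun Y hY => ?_, map_zero]
  have : T X Y ∈ Submodule.map (T X) (Submodule.span R s) := ⟨Y, Submodule.subset_span hY, rfl⟩
  rwa [hφs, Submodule.mem_bot] at this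

end Spanning


/-! ### Burnside's theorem and its descent from the algebraic closure. -/

section AbsolutelyIrreducible

theorem finiteDimensional_of_isIrreducible {K G U : Type*} [Field K] [Group G] [Finite G]
    [AddCommGroup U] [Module K U] {ρ : Representation K G U} (hρ : ρ.IsIrreducible) :
    FiniteDimensional K U := by
  have := (Representation.irreducible_iff_isSimpleModule_asModule ρ).1 hρ
  have : Module.Finite K (MonoidAlgebra K G) := 
    Module.Finite.equiv (MonoidAlgebra.coeffLinearEquiv K).symm
  have : Module.Finite K ρ.asModule := Module.Finite.trans (MonoidAlgebra K G) ρ.asModule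
  exact Module.Finite.equiv ρ.asModuleEquiv

/-- Burnside's theorem. -/
theorem span_range_eq_top_of_isIrreducible {K G U : Type*} [Field K] [IsAlgClosed K] [Group G]
    [AddCommGroup U] [Module K U] [FiniteDimensional K U] {ρ : Representation K G U}
    (hρ : ρ.IsIrreducible) : Submodule.span K (Set.range ρ) = ⊤ := by
  have := (Representation.irreducible_iff_isSimpleModule_asModule ρ).1 hρ
  have : Module.Finite K ρ.asModule := Module.Finite.equiv ρ.asModuleEquiv.symm
  rw [eq_top_iff]
  rintro f -
  let e := ρ.asModuleEquiv
  -- By Schur the commutant consists of scalars, so every `K`-linear `f` is linear over it and the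
  -- density theorem applies.
  let f' : Module.End (Module.End (MonoidAlgebra K G) ρ.asModule) ρ.asModule :=
    { toFun := fun m => e.symm (f (e m))
      map_add' := fun a b => by simp only [map_add]
      map_smul' := fun T m => by
        obtain ⟨c, rfl⟩ := (IsSimpleModule.algebraMap_end_bijective_of_isAlgClosed
          (A := MonoidAlgebra K G) (V := ρ.asModule) K).2 T
        simp only [RingHom.id_apply, Module.End.smul_def, Module.algebraMap_end_apply, map_smul] }
  obtain ⟨s, hs⟩ := Module.Finite.fg_top (R := K) (M := ρ.asModule)
  obtain ⟨r, hr⟩ := jacobson_density f' s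
  have hfr : f = ρ.asAlgebraHom r := by
    have : e.symm.toLinearMap ∘ₗ f ∘ₗ e.toLinearMap =
        e.symm.toLinearMap ∘ₗ ρ.asAlgebraHom r ∘ₗ e.toLinearMap := by
      refine LinearMap.ext_on hs fun m hm => ?_
      have h1 := hr m hm
      have h2 := congrArg e.symm (ρ.asModuleEquiv_map_smul r m)
      rw [LinearEquiv.symm_apply_apply] at h2
      exact h1.trans h2
    refine LinearMap.ext fun u => ?_
    have h := LinearMap.congr_fun this (e.symm u)
    simpa using h
  rw [hfr]
  clear hr hfr
  induction r using MonoidAlgebra.induction_on with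
  | of g => exact Submodule.subset_span ⟨g, (ρ.asAlgebraHom_of g).symm⟩
  | add a b ha hb => rw [map_add]; exact add_mem ha hb
  | smul c a ha => rw [map_smul]; exact Submodule.smul_mem _ c ha

variable {R G V : Type*} [Field R] [Group G] [AddCommGroup V] [Module R V]

theorem IsAbsolutelyIrreducible.finiteDimensional [Finite G] {π : Representation R G V}
    (h : IsAbsolutelyIrreducible π) : FiniteDimensional R V := by
  have hf := finiteDimensional_of_isIrreducible h
  have hr := Module.rank_lt_aleph0_iff.2 hf
  rw [Module.rank_baseChange, Cardinal.lift_lt_aleph0] at hr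
  exact Module.rank_lt_aleph0_iff.1 hr

theorem IsAbsolutelyIrreducible.nontrivial {π : Representation R G V}
    (h : IsAbsolutelyIrreducible π) : Nontrivial V := by
  by_contra hV
  rw [not_nontrivial_iff_subsingleton] at hV
  have hs : Subsingleton (AlgebraicClosure R ⊗[R] V) := inferInstance
  obtain ⟨a, b, hab⟩ := h.toNontrivial
  exact hab (Subrepresentation.toSubmodule_injective (Subsingleton.elim _ _))

/-- Descent through the trace form: an `X` orthogonal to the image of `π` stays orthogonal after
base change, where Burnside makes it zero. -/
theorem IsAbsolutelyIrreducible.span_range_eq_top [Finite G] {π : Representation R G V}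
    (h : IsAbsolutelyIrreducible π) : Submodule.span R (Set.range π) = ⊤ := by
  have := h.finiteDimensional
  have hK := span_range_eq_top_of_isIrreducible h
  refine span_eq_top_of_trace_mul fun X hX => ?_
  refine LinearMap.baseChangeHom_injective R V (AlgebraicClosure R) ?_
  rw [map_zero]
  refine eq_zero_of_trace_mul_eq_zero fun Y => ?_
  have hY : Y ∈ Submodule.span (AlgebraicClosure R)
      (Set.range (extendScalars (AlgebraicClosure R) π)) := hK ▸ trivial
  induction hY using Submodule.span_induction with
  | mem _ hg =>
    obtain ⟨g, rfl⟩ := hg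
    have e := LinearMap.trace_baseChange (X * π g) (AlgebraicClosure R)
    rw [hX _ ⟨g, rfl⟩, map_zero, Module.End.mul_eq_comp, LinearMap.baseChange_comp] at e
    exact e
  | zero => simp
  | add a b _ _ ha hb => rw [mul_add, map_add, ha, hb, add_zero]
  | smul c a _ ha => rw [mul_smul_comm, map_smul, ha, smul_zero]

end AbsolutelyIrreducible


/-! ### Multiplicity one and self-duality from a fixed vector. -/

section Gelfand

variable {R G V : Type*} [Field R] [Group G] [AddCommGroup V] [Module R V]

/-- The Gelfand–Kazhdan argument: if inversion preserves the double cosets of `H`, an invariant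
vector and an invariant form correspond under an isomorphism with the contragredient. -/
theorem exists_equiv_dual_of_invariant [FiniteDimensional R V] {H : Subgroup G}
    (hH : ∀ g : G, ∃ a ∈ H, ∃ b ∈ H, g⁻¹ = a * g * b) {π : Representation R G V}
    (hπ : Submodule.span R (Set.range π) = ⊤) {v : V} (hv : v ≠ 0) (hvH : ∀ h ∈ H, π h v = v)
    {φ : Module.Dual R V} (hφ : φ ≠ 0) (hφH : ∀ h ∈ H, ∀ x, φ (π h x) = φ x) :
    ∃ T : V ≃ₗ[R] Module.Dual R V, (∀ g x, T (π g x) = π.dual g (T x)) ∧ T v = φ := by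
  have symm : ∀ g, φ (π g⁻¹ v) = φ (π g v) := by
    intro g
    obtain ⟨a, ha, b, hb, e⟩ := hH g
    rw [e, map_mul, map_mul, Module.End.mul_apply, Module.End.mul_apply, hvH b hb, hφH a ha]
  -- For `f = g` this is `symm` at `h⁻¹g`. It shows that whatever annihilates `v` annihilates `φ`,
  -- the vectors `π(h)v` spanning `V`.
  have key : ∀ f h, π.dual.asAlgebraHom f φ (π h v) = φ (π h⁻¹ (π.asAlgebraHom f v)) := by
    intro f h
    induction f using MonoidAlgebra.induction_on with
    | of g =>
      rw [Representation.asAlgebraHom_of, Representation.asAlgebraHom_of]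
      change φ (π g⁻¹ (π h v)) = φ (π h⁻¹ (π g v))
      rw [← Module.End.mul_apply, ← Module.End.mul_apply, ← map_mul, ← map_mul, ← symm, mul_inv_rev,
        inv_inv]
    | add a b ha hb => simp only [map_add, LinearMap.add_apply, ha, hb]
    | smul c a ha => simp only [map_smul, LinearMap.smul_apply, ha]
  refine exists_equiv_of_annihilator_le hπ (span_range_dual_eq_top hπ) hv hφ fun f hf => ?_
  refine LinearMap.ext fun x => ?_
  obtain ⟨f', rfl⟩ := exists_asAlgebraHom_apply_eq hπ hv x
  rw [LinearMap.zero_apply]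
  induction f' using MonoidAlgebra.induction_on with
  | of g => rw [Representation.asAlgebraHom_of, key, hf, map_zero, map_zero]
  | add a b ha hb => rw [map_add, LinearMap.add_apply, map_add, ha, hb, add_zero]
  | smul c a ha => rw [map_smul, LinearMap.smul_apply, map_smul, ha, smul_zero]

/-- Schur's lemma for equivariant isomorphisms. -/
theorem exists_eq_smul_of_equivariant {W : Type*} [AddCommGroup W] [Module R W]
    {π : Representation R G V} {σ : Representation R G W}
    (hπ : Submodule.span R (Set.range π) = ⊤) (T T' : V ≃ₗ[R] W)
    (hT : ∀ g x, T (π g x) = σ g (T x)) (hT' : ∀ g x, T' (π g x) = σ g (T' x)) :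
    ∃ c : R, ∀ x, T' x = c • T x := by
  let Z : Module.End R V := T.symm.toLinearMap ∘ₗ T'.toLinearMap
  have hZ : Z ∈ Subalgebra.center R (Module.End R V) := by
    rw [Subalgebra.mem_center_iff]
    intro Y
    have hY : Y ∈ Submodule.span R (Set.range π) := hπ ▸ trivial
    induction hY using Submodule.span_induction with
    | mem _ hg =>
      obtain ⟨g, rfl⟩ := hg
      refine LinearMap.ext fun x => T.injective ?_
      change T (π g (T.symm (T' x))) = T (T.symm (T' (π g x)))
      rw [hT, T.apply_symm_apply, T.apply_symm_apply, hT']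
    | zero => rw [zero_mul, mul_zero]
    | add a b _ _ ha hb => rw [add_mul, mul_add, ha, hb]
    | smul c a _ ha => rw [smul_mul_assoc, mul_smul_comm, ha]
  rw [Algebra.IsCentral.center_eq_bot] at hZ
  obtain ⟨c, hc⟩ := Algebra.mem_bot.1 hZ
  refine ⟨c, fun x => ?_⟩
  have e : c • x = T.symm (T' x) := LinearMap.congr_fun hc x
  rw [← map_smul, e, T.apply_symm_apply]

/-- Multiplicity one and self-duality, given a vector fixed by `H`. -/
theorem finrank_invariantForms_eq_one [FiniteDimensional R V] {H : Subgroup G}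
    (hH : ∀ g : G, ∃ a ∈ H, ∃ b ∈ H, g⁻¹ = a * g * b) {π : Representation R G V}
    (hπ : Submodule.span R (Set.range π) = ⊤) {v : V} (hv : v ≠ 0) (hvH : ∀ h ∈ H, π h v = v)
    (hd : IsDistinguished H π) :
    Module.finrank R (InvariantForms H π) = 1 ∧ Nonempty (Representation.Equiv π π.dual) := by
  have inv : ∀ Λ : InvariantForms H π, ∀ h ∈ H, ∀ x, Λ.toLinearMap (π h x) = Λ.toLinearMap x :=
    fun Λ h hh x => Λ.isIntertwining _ _ ⟨h, hh⟩ x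
  have hne : ∀ Λ : InvariantForms H π, Λ ≠ 0 → Λ.toLinearMap ≠ 0 :=
    fun Λ h h0 => h (Representation.IntertwiningMap.ext h0)
  obtain ⟨Λ, hΛ⟩ := hd
  obtain ⟨T, hT, hTv⟩ := exists_equiv_dual_of_invariant hH hπ hv hvH (hne Λ hΛ) (inv Λ)
  refine ⟨finrank_eq_one_iff'.2 ⟨Λ, hΛ, fun Λ' => ?_⟩,
    ⟨Representation.Equiv.mk T fun g => LinearMap.ext fun x => hT g x⟩⟩
  by_cases hΛ' : Λ' = 0
  · exact ⟨0, by rw [hΛ', zero_smul]⟩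
  obtain ⟨T', hT', hTv'⟩ := exists_equiv_dual_of_invariant hH hπ hv hvH (hne Λ' hΛ') (inv Λ')
  obtain ⟨c, hc⟩ := exists_eq_smul_of_equivariant hπ T T' hT hT'
  refine ⟨c, Representation.IntertwiningMap.ext ?_⟩
  -- Both isomorphisms are evaluated at the same `v`, so their ratio is that of the forms.
  rw [← hTv', hc v, hTv]
  rfl

end Gelfand

/-! ### From an invariant form to a fixed vector. -/

section FixedVector

variable {k : Type*} [Field k] {ι : Type*} [Fintype ι] [DecidableEq ι]

/-- The automorphism `g ↦ (g⁻¹)ᵀ` of the general linear group. -/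
def transposeInv : Matrix.GeneralLinearGroup ι k →* Matrix.GeneralLinearGroup ι k where
  toFun g := ⟨(g⁻¹ : Matrix.GeneralLinearGroup ι k).val.transpose, g.val.transpose,
    by rw [← Matrix.transpose_mul, Units.mul_inv, Matrix.transpose_one],
    by rw [← Matrix.transpose_mul, Units.inv_mul, Matrix.transpose_one]⟩
  map_one' := Units.ext (by simp)
  map_mul' g h := Units.ext (by
    change (g * h)⁻¹.val.transpose = g⁻¹.val.transpose * h⁻¹.val.transpose
    rw [mul_inv_rev, Units.val_mul, Matrix.transpose_mul])

theorem val_transposeInv (g : Matrix.GeneralLinearGroup ι k) :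
    (transposeInv g).val = (g⁻¹).val.transpose := rfl

theorem transposeInv_transposeInv (g : Matrix.GeneralLinearGroup ι k) :
    transposeInv (transposeInv g) = g := Units.ext (by
  rw [val_transposeInv, ← map_inv, val_transposeInv, inv_inv, Matrix.transpose_transpose])

/-- For the centralizer of a matrix in the general linear group, an absolutely irreducible
representation with an invariant form has an invariant vector. -/
theorem exists_fixed_vector_of_invariant_form {R V : Type*} [Field R] [AddCommGroup V] [Module R V]
    [FiniteDimensional R V] [Nontrivial V] {J : Matrix ι ι k}
    {H : Subgroup (Matrix.GeneralLinearGroup ι k)} (hH : ∀ h, h ∈ H ↔ h.val * J = J * h.val)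
    {π : Representation R (Matrix.GeneralLinearGroup ι k) V}
    (hπ : Submodule.span R (Set.range π) = ⊤) {φ : Module.Dual R V} (hφ : φ ≠ 0)
    (hφH : ∀ h ∈ H, ∀ x, φ (π h x) = φ x) :
    ∃ v ≠ 0, ∀ h ∈ H, π h v = v := by
  let σ : Representation R (Matrix.GeneralLinearGroup ι k) V := π.comp transposeInv
  have hσ : Submodule.span R (Set.range σ) = ⊤ := by
    have : Set.range σ = Set.range π :=
      (Function.Involutive.surjective transposeInv_transposeInv).range_comp π
    rw [this, hπ]
  have htr : ∀ g, LinearMap.trace R _ (π.dual g) = LinearMap.trace R V (σ g) := by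
    intro g
    obtain ⟨P, hP⟩ := exists_mul_eq_transpose_mul (g⁻¹).val
    have e : transposeInv g = P * g⁻¹ * P⁻¹ := by
      rw [eq_mul_inv_iff_mul_eq]
      exact Units.ext hP.symm
    change _ = LinearMap.trace R V (π (transposeInv g))
    rw [e, map_mul, LinearMap.trace_mul_comm, ← map_mul, inv_mul_cancel_left,
      Representation.dual_apply, LinearMap.trace_transpose']
  obtain ⟨T, hT⟩ := exists_equiv_of_trace_eq (span_range_dual_eq_top hπ) hσ htr
  obtain ⟨P, hP⟩ := exists_mul_eq_transpose_mul J
  -- `T φ` is fixed by the image of `H` under `transposeInv`, the centralizer of `Jᵀ`, which is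
  -- `PHP⁻¹`; applying `π P⁻¹` moves it to a vector fixed by `H`.
  refine ⟨π P⁻¹ (T φ), fun h0 => hφ ?_, fun h hh => ?_⟩
  · have e := congrArg (π P) h0
    rw [map_zero, ← Module.End.mul_apply, ← map_mul, mul_inv_cancel, map_one] at e
    exact (map_eq_zero_iff T T.injective).1 e
  · let h' := transposeInv (P * h * P⁻¹)
    have hh' : h'⁻¹ ∈ H := by
      rw [hH] at hh ⊢
      have e₁ : (P * h * P⁻¹).val * J.transpose = J.transpose * (P * h * P⁻¹).val := by
        have e₂ : P⁻¹.val * J.transpose = J * P⁻¹.val := by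
          rw [Units.inv_mul_eq_iff_eq_mul, ← mul_assoc, hP, mul_assoc, Units.mul_inv, mul_one]
        rw [Units.val_mul, Units.val_mul, mul_assoc, e₂, ← mul_assoc, mul_assoc P.val, hh,
          ← mul_assoc P.val, hP]
        simp only [mul_assoc]
      have e₃ := congrArg Matrix.transpose e₁
      rw [Matrix.transpose_mul, Matrix.transpose_mul, Matrix.transpose_transpose] at e₃
      have e₄ : (h'⁻¹).val = (P * h * P⁻¹).val.transpose := by
        rw [← map_inv, val_transposeInv, inv_inv]
      rw [e₄, e₃]
    have fix : π.dual h' φ = φ := LinearMap.ext fun x => hφH _ hh' x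
    have e := hT h' φ
    rw [fix] at e
    change T φ = π (transposeInv (transposeInv (P * h * P⁻¹))) (T φ) at e
    rw [transposeInv_transposeInv] at e
    conv_rhs => rw [e]
    rw [← Module.End.mul_apply, ← Module.End.mul_apply, ← map_mul, ← map_mul]
    congr 2
    group

end FixedVector

end TwistedLinear

theorem mainTheorem10 {k : Type*} {l : Type*} [Field k] [Finite k] [Field l] [Algebra k l]
    (hl : Module.finrank k l = 2) (m : ℕ) (hm : 1 ≤ m)
    (φ : Matrix (Fin m) (Fin m) l →ₐ[k] Matrix (Fin (2 * m)) (Fin (2 * m)) k) :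
    (∀ g : Matrix.GeneralLinearGroup (Fin (2 * m)) k,
      DoubleCoset.doubleCoset g⁻¹ (TwistedLinear.twistedSubgroup φ)
          (TwistedLinear.twistedSubgroup φ) =
        DoubleCoset.doubleCoset g (TwistedLinear.twistedSubgroup φ)
          (TwistedLinear.twistedSubgroup φ)) ∧
    ∀ (R : Type*) [Field R], ringChar R ≠ ringChar k →
      ∀ (V : Type*) [AddCommGroup V] [Module R V]
        (π : Representation R (Matrix.GeneralLinearGroup (Fin (2 * m)) k) V),
        TwistedLinear.IsAbsolutelyIrreducible π →
        TwistedLinear.IsDistinguished (TwistedLinear.twistedSubgroup φ) π →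
          Module.finrank R (TwistedLinear.InvariantForms (TwistedLinear.twistedSubgroup φ) π) = 1 ∧
          Nonempty (Representation.Equiv π π.dual) := by
  obtain ⟨J, hJ, hinv⟩ := TwistedLinear.exists_inv_eq_mul_mul hl hm φ
  refine ⟨fun g => DoubleCoset.doubleCoset_eq_of_mem (DoubleCoset.mem_doubleCoset.2 (hinv g)), ?_⟩
  intro R _ _ V _ _ π hπ hd
  have := hπ.finiteDimensional
  have := hπ.nontrivial
  obtain ⟨Λ, hΛ⟩ := hd
  obtain ⟨v, hv, hvH⟩ := TwistedLinear.exists_fixed_vector_of_invariant_form hJ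
    hπ.span_range_eq_top (fun h0 => hΛ (Representation.IntertwiningMap.ext h0))
    (fun h hh x => Λ.isIntertwining _ _ ⟨h, hh⟩ x)
  exact TwistedLinear.finrank_invariantForms_eq_one hinv hπ.span_range_eq_top hv hvH ⟨Λ, hΛ⟩
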